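/- Write $[K]$ for a set of $K$ elements. A quantum algorithm making $q$ queries to an unknown function $f:[M]\to[N]$ is given by a query register with basis $[M]$, a response register whose basis is a finite abelian group $G$ together with an injective encoding $e:[N]\to G$ (for example $G=\{0,1\}^b$ with XOR, or $G=\mathbb{Z}/N$), a finite-dimensional workspace, a fixed computational basis state as initial state, and unitaries $U_0,\dots,U_q$ not depending on $f$. It prepares $U_q O_f U_{q-1} O_f\cdots U_1 O_f U_0|\mathrm{start}\rangle$, where $O_f|x,y,w\rangle=|x,y+e(f(x)),w\rangle$, measures all registers in the computational basis, and computes from the result a pair $(x_1,x_2)\in[M]^2$ as its output. The output is a collision for $f$ if $x_1\ne x_2$ and $f(x_1)=f(x_2)$. **Theorem.** (a) There is a universal constant $C>0$ such that for all integers $M\ge 0$, $N\ge 1$, $q\ge 0$, every such group $G$ and encoding $e$, and every quantum algorithm making $q$ queries, if $f:[M]\to[N]$ is uniformly random, then the algorithm outputs a collision for $f$ with probability (over $f$ and the measurement) at most $$\frac{C\,(q+1)^3}{N}.$$ (b) Consequently, finding a collision with constant probability requires $\Omega(N^{1/3})$ queries, uniformly in $M$: for every $p>0$ there are $c>0$ and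 $N_0$ such that for all $N\ge N_0$, all $M$ and $q$, and all $G$ and $e$ as above, every quantum algorithm making $q$ queries that outputs a collision for a uniformly random $f:[M]\to[N]$ with probability at least $p$ satisfies $q\ge c\,N^{1/3}$. -/

import Mathlib

/-- A quantum algorithm making exactly `q` queries to an unknown function `[M] → [N]` and outputting
a pair of elements of `[M]`.  Its registers are the query register (basis `Fin M`), the response
register (basis a finite abelian group `G`) and a workspace of arbitrary finite dimension `dim`.
It starts in a computational basis state and applies arbitrary unitaries `U 0, …, U q`, with one
query between any two consecutive ones; then all registers are measured in the computational basis
and the output is computed from the measured basis state. -/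
structure QueryAlgorithm (M : ℕ) (G : Type) [Fintype G] [DecidableEq G] (q : ℕ) where
  /-- dimension of the workspace -/
  dim : ℕ
  /-- the initial basis state -/
  start : Fin M × G × Fin dim
  /-- the unitaries, which do not depend on the unknown function -/
  U : Fin (q + 1) → Matrix.unitaryGroup (Fin M × G × Fin dim) ℂ
  /-- classical post-processing of the measured basis state -/
  out : Fin M × G × Fin dim → Fin M × Fin M

/-- One quantum query to `f : [M] → [N]`, where `enc` encodes `[N]` in the group `G`: the linear map
with `|x, y, w⟩ ↦ |x, y + enc (f x), w⟩`, acting on vectors of amplitudes.  For `G = {0,1}^b` this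
is the XOR query to `b` qubits, for `G = ℤ/N` it is addition modulo `N`. -/
def quantumQuery {M N : ℕ} {G W : Type} [AddCommGroup G] (enc : Fin N ↪ G) (f : Fin M → Fin N)
    (ψ : Fin M × G × W → ℂ) : Fin M × G × W → ℂ :=
  fun z => ψ (z.1, z.2.1 - enc (f z.1), z.2.2)

/-- `(x₁, x₂)` is a collision for `f`. -/
def IsCollision {M N : ℕ} (f : Fin M → Fin N) (p : Fin M × Fin M) : Prop :=
  p.1 ≠ p.2 ∧ f p.1 = f p.2

namespace QueryAlgorithm

variable {M N : ℕ} {G : Type} [AddCommGroup G] [Fintype G] [DecidableEq G] {q : ℕ}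

/-- The state `U k · O_f · U (k-1) ⋯ U 1 · O_f · U 0 |start⟩` after `k ≤ q` queries to `f`. -/
noncomputable def stateAfter (A : QueryAlgorithm M G q) (enc : Fin N ↪ G) (f : Fin M → Fin N) :
    (k : ℕ) → k ≤ q → (Fin M × G × Fin A.dim → ℂ)
  | 0, _ => (A.U 0 : Matrix _ _ ℂ).mulVec (Pi.single A.start 1)
  | k + 1, hk => (A.U ⟨k + 1, Nat.lt_succ_of_le hk⟩ : Matrix _ _ ℂ).mulVec
      (quantumQuery enc f (A.stateAfter enc f k (Nat.le_of_succ_le hk)))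

open Classical in
/-- The probability that `A`, run with queries to the fixed function `f`, outputs a collision
for `f`. -/
noncomputable def collisionProb (A : QueryAlgorithm M G q) (enc : Fin N ↪ G)
    (f : Fin M → Fin N) : ℝ :=
  ∑ z, if IsCollision f (A.out z) then ‖A.stateAfter enc f q le_rfl z‖ ^ 2 else 0

/-- The probability that `A` outputs a collision for `f`, over a uniformly random `f : [M] → [N]`
and the measurement. -/
noncomputable def randomCollisionProb (A : QueryAlgorithm M G q) (enc : Fin N ↪ G) : ℝ :=
  (∑ f : Fin M → Fin N, A.collisionProb enc f) / (Fintype.card (Fin M → Fin N) : ℝ)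

end QueryAlgorithm

/-! This is Zhandry's compressed oracle method. The random `f` is kept in uniform superposition, one
register per point of `[M]`. The matrix `T = decompress` has orthonormal rows, so `Tᵀ` (compression)
is an isometry, `T` is a contraction and `T Tᵀ = 1`. A register in `none` decompresses to the
uniform superposition: nothing is known about that value. The compressed query is `Tᵀ O T` on the
queried register. Because `T Tᵀ = 1`, decompression carries it to the true query, so the compressed
run started from the empty database decompresses to the superposition over `f` of the true runs
(`decompressAll_compressedState`).

After `k` queries at most `k` values are recorded. A new collision must hit one of them, and each
given value receives squared amplitude at most `6 / N` (`sum_norm_sq_registerQuery_some_le`), so one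
query creates collision mass at most `6 * k / N`. Amplitudes add, so the norm of the collision part
grows by about `√(6 * k / N)` per query and its square stays below `6 * k ^ 3 / N`. A database
without a recorded collision yields a given output collision with mass at most `8 / N`
(`sum_norm_sq_decompressAll_isCollision_le`). Adding the two contributions gives the cubic bound. -/

open Finset Function

/-! ### Matrices with orthonormal rows, and norm inequalities -/

/-- If the rows of a real matrix are orthonormal, its transpose preserves the sum of squares. -/
theorem sum_norm_sq_transpose_of_orthonormal {ι κ : Type*} [Fintype ι] [DecidableEq ι] [Fintype κ]
    {t : ι → κ → ℝ} (ht : ∀ a b, ∑ d, t a d * t b d = if a = b then 1 else 0) (c : ι → ℂ) :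
    ∑ d, ‖∑ v, (t v d : ℂ) * c v‖ ^ 2 = ∑ v, ‖c v‖ ^ 2 := by
  have hC : ∀ a b, ∑ d, (t a d : ℂ) * (t b d : ℂ) = if a = b then 1 else 0 := fun a b => by
    have h := congrArg (fun r : ℝ => (r : ℂ)) (ht a b)
    push_cast at h
    rw [h]
    split_ifs <;> simp
  apply Complex.ofReal_injective
  push_cast
  simp only [← Complex.mul_conj', map_sum, map_mul, Complex.conj_ofReal, Finset.sum_mul_sum]
  rw [Finset.sum_comm]
  refine Finset.sum_congr rfl fun a _ => ?_
  rw [Finset.sum_comm]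
  calc _ = ∑ b, (∑ d, (t a d : ℂ) * t b d) * (c a * (starRingEnd ℂ) (c b)) := by
        refine Finset.sum_congr rfl fun b _ => ?_
        rw [Finset.sum_mul]
        exact Finset.sum_congr rfl fun d _ => by ring
    _ = _ := by simp [hC]

/-- A real matrix with orthonormal rows is a contraction. -/
theorem sum_norm_sq_le_of_orthonormal {ι κ : Type*} [Fintype ι] [DecidableEq ι] [Fintype κ]
    {t : ι → κ → ℝ} (ht : ∀ a b, ∑ d, t a d * t b d = if a = b then 1 else 0) (φ : κ → ℂ) :
    ∑ v, ‖∑ d, (t v d : ℂ) * φ d‖ ^ 2 ≤ ∑ d, ‖φ d‖ ^ 2 := by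
  set c : ι → ℂ := fun v => ∑ d, (t v d : ℂ) * φ d with hc
  set s : κ → ℂ := fun d => ∑ v, (t v d : ℂ) * c v with hs
  have h1 : ∑ d, ‖s d‖ ^ 2 = ∑ v, ‖c v‖ ^ 2 := sum_norm_sq_transpose_of_orthonormal ht c
  have h2 : ∑ d, φ d * (starRingEnd ℂ) (s d) = ((∑ v, ‖c v‖ ^ 2 : ℝ) : ℂ) := by
    push_cast
    simp only [← Complex.mul_conj', hs, map_sum, map_mul, Complex.conj_ofReal, Finset.mul_sum]
    rw [Finset.sum_comm]
    refine Finset.sum_congr rfl fun v _ => ?_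
    conv_rhs => rw [hc]
    simp only [Finset.sum_mul]
    exact Finset.sum_congr rfl fun d _ => by simp only [hc]; ring
  have h3 : ∀ d, ‖φ d - s d‖ ^ 2
      = ‖φ d‖ ^ 2 + ‖s d‖ ^ 2 - 2 * (φ d * (starRingEnd ℂ) (s d)).re := fun d => by
    simp only [← Complex.normSq_eq_norm_sq, Complex.normSq_sub]
  -- Bessel's inequality: `s` is the projection of `φ` to the row space, and both its square norm
  -- and its inner product with `φ` equal the square norm of `c`.
  have h4 : 0 ≤ ∑ d, ‖φ d - s d‖ ^ 2 := Finset.sum_nonneg fun d _ => by positivity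
  have h5 := congrArg Complex.re h2
  rw [Complex.re_sum, Complex.ofReal_re] at h5
  simp only [h3, Finset.sum_sub_distrib, Finset.sum_add_distrib, ← Finset.mul_sum] at h4
  linarith

/-- Cauchy–Schwarz for a real and a complex vector. -/
theorem norm_sq_sum_ofReal_mul_le {κ : Type*} (s : Finset κ) (t : κ → ℝ) (φ : κ → ℂ) :
    ‖∑ d ∈ s, (t d : ℂ) * φ d‖ ^ 2 ≤ (∑ d ∈ s, t d ^ 2) * ∑ d ∈ s, ‖φ d‖ ^ 2 := by
  have h : ‖∑ d ∈ s, (t d : ℂ) * φ d‖ ≤ ∑ d ∈ s, |t d| * ‖φ d‖ := by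
    refine (norm_sum_le _ _).trans (Finset.sum_le_sum fun d _ => ?_)
    simp
  calc _ ≤ (∑ d ∈ s, |t d| * ‖φ d‖) ^ 2 := by gcongr
    _ ≤ (∑ d ∈ s, |t d| ^ 2) * ∑ d ∈ s, ‖φ d‖ ^ 2 := Finset.sum_mul_sq_le_sq_mul_sq _ _ _
    _ = _ := by simp

theorem norm_add_sq_le_two_mul (x y : ℂ) : ‖x + y‖ ^ 2 ≤ 2 * ‖x‖ ^ 2 + 2 * ‖y‖ ^ 2 := by
  have h := norm_add_le x y
  have := norm_nonneg (x + y)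
  nlinarith [sq_nonneg (‖x‖ - ‖y‖)]

/-! ### Comparing sums over databases along one coordinate -/

section Fiber

variable {ι α : Type*} [Fintype ι] [DecidableEq ι] [Fintype α]

/-- Summing over all values of one coordinate first counts every function `card α` times. -/
theorem sum_sum_update {R : Type*} [NonAssocSemiring R] (x : ι) (F : (ι → α) → R) :
    ∑ D, ∑ d, F (update D x d) = Fintype.card α * ∑ D, F D := by
  have e := fun H : (ι → α) → R => Fintype.sum_equiv (Equiv.funSplitAt x α) H
    (fun p => H ((Equiv.funSplitAt x α).symm p))
    (fun D => by rw [Equiv.symm_apply_apply])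
  have hu : ∀ (p : α × ({j // j ≠ x} → α)) d, update ((Equiv.funSplitAt x α).symm p) x d
      = (Equiv.funSplitAt x α).symm (d, p.2) := fun p d => by
    ext j
    by_cases hj : j = x
    · subst hj; simp [Equiv.funSplitAt, Equiv.piSplitAt]
    · simp [Equiv.funSplitAt, Equiv.piSplitAt, hj]
  rw [e, e F]
  simp only [hu, Fintype.sum_prod_type]
  rw [Finset.sum_const, Finset.card_univ, nsmul_eq_mul]
  rw [Finset.sum_comm]

theorem sum_le_sum_of_update [Nonempty α] (x : ι) {a b : (ι → α) → ℝ}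
    (h : ∀ D, ∑ d, a (update D x d) ≤ ∑ d, b (update D x d)) : ∑ D, a D ≤ ∑ D, b D := by
  have h1 := Finset.sum_le_sum fun D (_ : D ∈ univ) => h D
  rw [sum_sum_update, sum_sum_update] at h1
  exact le_of_mul_le_mul_left h1 (by exact_mod_cast Fintype.card_pos)

theorem sum_eq_sum_of_update [Nonempty α] (x : ι) {a b : (ι → α) → ℂ}
    (h : ∀ D, ∑ d, a (update D x d) = ∑ d, b (update D x d)) : ∑ D, a D = ∑ D, b D := by
  have h1 := Finset.sum_congr rfl fun D (_ : D ∈ univ) => h D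
  rw [sum_sum_update, sum_sum_update] at h1
  exact mul_left_cancel₀ (by exact_mod_cast Fintype.card_ne_zero) h1

end Fiber

/-! ### Compression of one register -/

/-- The matrix expanding a truth-table register in the compressed basis: `none` stands for the
uniform superposition and `some w` for the projection of `|w⟩` orthogonal to it. -/
noncomputable def decompress {N : ℕ} (v : Fin N) : Option (Fin N) → ℝ
  | none => 1 / √N
  | some w => (if v = w then 1 else 0) - 1 / N

section Decompress

variable {N : ℕ}

theorem decompress_orthonormal (a b : Fin N) :
    ∑ d, decompress a d * decompress b d = if a = b then 1 else 0 := by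
  have hN : (0 : ℝ) < N := by exact_mod_cast Fin.pos a
  have hs : √(N : ℝ) * √(N : ℝ) = N := Real.mul_self_sqrt hN.le
  rw [Fintype.sum_option]
  simp only [decompress, sub_mul, mul_sub, Finset.sum_sub_distrib]
  simp only [mul_ite, ite_mul, one_mul, zero_mul, mul_one, mul_zero, Finset.sum_ite_eq,
    Finset.mem_univ, if_true, Finset.sum_const, Finset.card_univ, Fintype.card_fin, nsmul_eq_mul]
  rw [div_mul_div_comm, hs]
  have : (N : ℝ) * (1 / N * (1 / N)) = 1 / N := by field_simp
  rw [this]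
  by_cases h : a = b <;> simp [h]

/-- Row `v` is a unit vector with entry `1 - 1 / N` at `some v`, which leaves `1 - (1 - 1 / N) ^ 2 ≤
2 / N` for the other entries. -/
theorem sum_decompress_sq_le [DecidableEq (Option (Fin N))] (v : Fin N) :
    ∑ d ∈ univ.erase (some v), decompress v d ^ 2 ≤ 2 / N := by
  have hN : (1 : ℝ) ≤ N := by exact_mod_cast Fin.pos v
  have h1 := decompress_orthonormal v v
  rw [if_pos rfl, ← Finset.add_sum_erase _ _ (Finset.mem_univ (some v))] at h1
  simp only [← pow_two] at h1
  have h2 : decompress v (some v) = 1 - 1 / N := by simp [decompress]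
  rw [h2] at h1
  have : (0 : ℝ) ≤ (1 / N) ^ 2 := by positivity
  have h3 : (2 : ℝ) / N = 2 * (1 / N) := by ring
  rw [h3]
  nlinarith

theorem norm_sq_sum_erase_decompress_le [DecidableEq (Option (Fin N))] (v : Fin N)
    (φ : Option (Fin N) → ℂ) :
    ‖∑ d ∈ univ.erase (some v), (decompress v d : ℂ) * φ d‖ ^ 2 ≤ 2 / N * ∑ d, ‖φ d‖ ^ 2 := by
  refine (norm_sq_sum_ofReal_mul_le _ _ _).trans ?_
  have := sum_decompress_sq_le v
  gcongr
  exact Finset.erase_subset _ _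

theorem norm_sq_sum_decompress_le (v : Fin N) {φ : Option (Fin N) → ℂ} (h : φ (some v) = 0) :
    ‖∑ d, (decompress v d : ℂ) * φ d‖ ^ 2 ≤ 2 / N * ∑ d, ‖φ d‖ ^ 2 := by
  classical
  rw [← Finset.add_sum_erase _ _ (Finset.mem_univ (some v)), h, mul_zero, zero_add]
  exact norm_sq_sum_erase_decompress_le v φ

/-- The probability that two decompressed registers agree is small if the compressed ones hold no
common value. -/
theorem sum_norm_sq_decompress_diag_le {α : Option (Fin N) → Option (Fin N) → ℂ}
    (h : ∀ v, α (some v) (some v) = 0) :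
    ∑ v, ‖∑ d₁, ∑ d₂, (decompress v d₁ : ℂ) * decompress v d₂ * α d₁ d₂‖ ^ 2
      ≤ 8 / N * ∑ d₁, ∑ d₂, ‖α d₁ d₂‖ ^ 2 := by
  classical
  set χ : Fin N → Option (Fin N) → ℂ := fun v d₂ => ∑ d₁, (decompress v d₁ : ℂ) * α d₁ d₂ with hχ
  have hcomm : ∑ d₁, ∑ d₂, ‖α d₁ d₂‖ ^ 2 = ∑ d₂, ∑ d₁, ‖α d₁ d₂‖ ^ 2 := Finset.sum_comm
  have hv : ∀ v, ‖∑ d₁, ∑ d₂, (decompress v d₁ : ℂ) * decompress v d₂ * α d₁ d₂‖ ^ 2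
      ≤ 4 / N * (∑ d₁, ‖α d₁ (some v)‖ ^ 2) + 4 / N * ∑ d₂, ‖χ v d₂‖ ^ 2 := fun v => by
    -- Split off `d₂ = some v`. There `d₁ = some v` is excluded by hypothesis, so `d₁` supplies the
    -- factor `2 / N`; in the remaining sum `d₂` supplies it. Squaring the sum of the two parts
    -- doubles each factor to `4 / N`.
    have h1 : ∑ d₁, ∑ d₂, (decompress v d₁ : ℂ) * decompress v d₂ * α d₁ d₂
        = decompress v (some v) * χ v (some v)
          + ∑ d ∈ univ.erase (some v), (decompress v d : ℂ) * χ v d := by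
      rw [Finset.add_sum_erase _ (fun d => (decompress v d : ℂ) * χ v d) (Finset.mem_univ (some v)),
        Finset.sum_comm]
      refine Finset.sum_congr rfl fun d _ => ?_
      rw [hχ, Finset.mul_sum]
      exact Finset.sum_congr rfl fun _ _ => by ring
    have h2 : ‖χ v (some v)‖ ^ 2 ≤ 2 / N * ∑ d₁, ‖α d₁ (some v)‖ ^ 2 :=
      norm_sq_sum_decompress_le v (h v)
    have h3 := norm_sq_sum_erase_decompress_le v (χ v)
    have h4 : ‖(decompress v (some v) : ℂ) * χ v (some v)‖ ^ 2 ≤ ‖χ v (some v)‖ ^ 2 := by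
      have hN : (1 : ℝ) ≤ N := by exact_mod_cast Fin.pos v
      have h5 : (1 : ℝ) / N ≤ 1 := by rw [div_le_one (by positivity)]; exact hN
      have h6 : (0 : ℝ) ≤ 1 / N := by positivity
      have h7 : ‖(decompress v (some v) : ℂ)‖ ≤ 1 := by
        rw [Complex.norm_real, Real.norm_eq_abs, abs_le]
        simp only [decompress, if_true]
        constructor <;> linarith
      rw [norm_mul]
      gcongr
      exact mul_le_of_le_one_left (norm_nonneg _) h7
    rw [h1]
    refine (norm_add_sq_le_two_mul _ _).trans ?_
    have e : (4 : ℝ) / N = 2 * (2 / N) := by ring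
    rw [e]
    linarith
  refine (Finset.sum_le_sum fun v _ => hv v).trans ?_
  rw [Finset.sum_add_distrib, ← Finset.mul_sum, ← Finset.mul_sum]
  -- The columns `d₂ = some v` are disjoint for distinct `v`, so summing over `v` costs no factor
  -- `N`.
  have h8 : ∑ v : Fin N, ∑ d₁, ‖α d₁ (some v)‖ ^ 2 ≤ ∑ d₁, ∑ d₂, ‖α d₁ d₂‖ ^ 2 := by
    rw [hcomm, Fintype.sum_option]
    exact le_add_of_nonneg_left (by positivity)
  have h9 : ∑ v, ∑ d₂, ‖χ v d₂‖ ^ 2 ≤ ∑ d₁, ∑ d₂, ‖α d₁ d₂‖ ^ 2 := by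
    rw [hcomm, Finset.sum_comm]
    exact Finset.sum_le_sum fun d _ => sum_norm_sq_le_of_orthonormal decompress_orthonormal _
  have e : (8 : ℝ) / N = 4 / N + 4 / N := by ring
  rw [e, add_mul]
  gcongr

end Decompress

/-! ### One query on one register -/

/-- A query in the compressed picture, acting on the queried register and the response register. -/
noncomputable def registerQuery {N : ℕ} {G : Type} [AddCommGroup G] (enc : Fin N ↪ G)
    (φ : Option (Fin N) → G → ℂ) (d : Option (Fin N)) (y : G) : ℂ :=
  ∑ v, (decompress v d : ℂ) * ∑ d', (decompress v d' : ℂ) * φ d' (y - enc v)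

section RegisterQuery

variable {N : ℕ} {G : Type} [AddCommGroup G] [Fintype G] (enc : Fin N ↪ G)

theorem sum_norm_sq_shift_decompress_le (φ : Option (Fin N) → G → ℂ) :
    ∑ y, ∑ v, ‖∑ d, (decompress v d : ℂ) * φ d (y - enc v)‖ ^ 2 ≤ ∑ d, ∑ y, ‖φ d y‖ ^ 2 := by
  rw [Finset.sum_comm]
  have h : ∀ v, ∑ y, ‖∑ d, (decompress v d : ℂ) * φ d (y - enc v)‖ ^ 2
      = ∑ y, ‖∑ d, (decompress v d : ℂ) * φ d y‖ ^ 2 := fun v =>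
    Fintype.sum_equiv (Equiv.subRight (enc v)) _ _ fun y => rfl
  simp only [h]
  rw [Finset.sum_comm, Finset.sum_comm (f := fun d y => ‖φ d y‖ ^ 2)]
  exact Finset.sum_le_sum fun y _ => sum_norm_sq_le_of_orthonormal decompress_orthonormal _

theorem sum_norm_sq_registerQuery_le (φ : Option (Fin N) → G → ℂ) :
    ∑ d, ∑ y, ‖registerQuery enc φ d y‖ ^ 2 ≤ ∑ d, ∑ y, ‖φ d y‖ ^ 2 := by
  rw [Finset.sum_comm]
  refine le_trans (le_of_eq ?_) (sum_norm_sq_shift_decompress_le enc φ)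
  exact Finset.sum_congr rfl fun y _ =>
    sum_norm_sq_transpose_of_orthonormal decompress_orthonormal _

/-- A query hardly ever puts a given new value into the queried register. -/
theorem sum_norm_sq_registerQuery_some_le {φ : Option (Fin N) → G → ℂ} {i : Fin N}
    (h : φ (some i) = 0) :
    ∑ y, ‖registerQuery enc φ (some i) y‖ ^ 2 ≤ 6 / N * ∑ d, ∑ y, ‖φ d y‖ ^ 2 := by
  have hN : (0 : ℝ) < N := by exact_mod_cast Fin.pos i
  set ψ : Fin N → G → ℂ := fun v y => ∑ d, (decompress v d : ℂ) * φ d (y - enc v) with hψ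
  -- Compression to `some i` takes the amplitude at `i` minus the mean. The first is small because
  -- `φ (some i) = 0` (mass `2 / N`), the mean by Cauchy–Schwarz (mass `1 / N`); doubling gives `6 /
  -- N`.
  have h1 : ∀ y, registerQuery enc φ (some i) y
      = ψ i y + ∑ v, ((-(1 / N) : ℝ) : ℂ) * ψ v y := fun y => by
    have h0 : ∀ v, (decompress v (some i) : ℂ) = (if v = i then 1 else 0) + (-(1 / N) : ℝ) :=
      fun v => by simp only [decompress, sub_eq_add_neg]; push_cast; split_ifs <;> simp
    change ∑ v, (decompress v (some i) : ℂ) * ψ v y = _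
    simp [h0, add_mul, Finset.sum_add_distrib]
  have h2 : ∀ y, ‖registerQuery enc φ (some i) y‖ ^ 2
      ≤ 2 * ‖ψ i y‖ ^ 2 + 2 / N * ∑ v, ‖ψ v y‖ ^ 2 := fun y => by
    rw [h1]
    refine (norm_add_sq_le_two_mul _ _).trans ?_
    have := norm_sq_sum_ofReal_mul_le univ (fun _ : Fin N => (-(1 / N) : ℝ)) (fun v => ψ v y)
    have e : ∑ _v : Fin N, (-(1 / N) : ℝ) ^ 2 = 1 / N := by
      rw [Finset.sum_const, Finset.card_univ, Fintype.card_fin, nsmul_eq_mul]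
      field_simp
    rw [e] at this
    have e2 : (2 : ℝ) / N = 2 * (1 / N) := by ring
    rw [e2, mul_assoc]
    gcongr
  have h3 : ∑ y, ‖ψ i y‖ ^ 2 ≤ 2 / N * ∑ d, ∑ y, ‖φ d y‖ ^ 2 := by
    have : ∑ y, ‖ψ i y‖ ^ 2 = ∑ y, ‖∑ d, (decompress i d : ℂ) * φ d y‖ ^ 2 :=
      Fintype.sum_equiv (Equiv.subRight (enc i)) _ _ fun y => rfl
    rw [this, Finset.sum_comm, Finset.mul_sum]
    exact Finset.sum_le_sum fun y _ => norm_sq_sum_decompress_le i (congrFun h y)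
  have h4 := sum_norm_sq_shift_decompress_le enc φ
  refine (Finset.sum_le_sum fun y _ => h2 y).trans ?_
  rw [Finset.sum_add_distrib, ← Finset.mul_sum, ← Finset.mul_sum]
  have e : (6 : ℝ) / N = 2 * (2 / N) + 2 / N := by ring
  rw [e, add_mul, mul_assoc]
  gcongr

end RegisterQuery

/-! ### Queries on the whole database -/

/-- A query in the compressed picture: the register of the database at the queried point is
decompressed, queried and compressed again. -/
noncomputable def compressedQuery {M N : ℕ} {G W : Type} [AddCommGroup G] (enc : Fin N ↪ G)
    (Φ : (Fin M → Option (Fin N)) → Fin M × G × W → ℂ) (D : Fin M → Option (Fin N))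
    (z : Fin M × G × W) : ℂ :=
  registerQuery enc (fun d y => Φ (update D z.1 d) (z.1, y, z.2.2)) (D z.1) z.2.1

/-- Two points of the database hold the same recorded value. -/
def HasCollision {M N : ℕ} (D : Fin M → Option (Fin N)) : Prop :=
  ∃ x₁ x₂, x₁ ≠ x₂ ∧ ∃ v, D x₁ = some v ∧ D x₂ = some v

/-- The number of recorded values. -/
def recordCount {M N : ℕ} (D : Fin M → Option (Fin N)) : ℕ := #{x | D x ≠ none}

section CompressedQuery

variable {M N : ℕ}

theorem recordCount_le_update_add_one (D : Fin M → Option (Fin N)) (x : Fin M)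
    (d : Option (Fin N)) : recordCount D ≤ recordCount (update D x d) + 1 := by
  refine (Finset.card_le_card (t := insert x ({y | update D x d y ≠ none} : Finset _)) ?_).trans
    (Finset.card_insert_le _ _)
  intro y hy
  rcases eq_or_ne y x with rfl | h <;> simp_all

/-- A query preserves `x`, `w` and every database entry away from `x`, so norm bounds for it reduce
to these blocks. -/
theorem sum_le_sum_of_register {G W : Type} [Fintype G] [Fintype W]
    {a b : (Fin M → Option (Fin N)) → Fin M × G × W → ℝ}
    (h : ∀ D x w, ∑ d, ∑ y, a (update D x d) (x, y, w) ≤ ∑ d, ∑ y, b (update D x d) (x, y, w)) :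
    ∑ D, ∑ z, a D z ≤ ∑ D, ∑ z, b D z := by
  have e : ∀ c : (Fin M → Option (Fin N)) → Fin M × G × W → ℝ,
      ∑ D, ∑ z, c D z = ∑ x, ∑ w, ∑ D, ∑ y, c D (x, y, w) := fun c => by
    simp only [Fintype.sum_prod_type]
    rw [Finset.sum_comm]
    refine Finset.sum_congr rfl fun x _ => ?_
    rw [Finset.sum_comm (s := (univ : Finset W))]
    exact Finset.sum_congr rfl fun D _ => Finset.sum_comm
  rw [e, e]
  exact Finset.sum_le_sum fun x _ => Finset.sum_le_sum fun w _ =>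
    sum_le_sum_of_update x fun D => h D x w

variable {G W : Type} [AddCommGroup G] (enc : Fin N ↪ G)

theorem compressedQuery_update (Φ : (Fin M → Option (Fin N)) → Fin M × G × W → ℂ)
    (D : Fin M → Option (Fin N)) (x : Fin M) (d : Option (Fin N)) (y : G) (w : W) :
    compressedQuery enc Φ (update D x d) (x, y, w)
      = registerQuery enc (fun d y => Φ (update D x d) (x, y, w)) d y := by
  simp [compressedQuery]

theorem compressedQuery_add (Φ Φ' : (Fin M → Option (Fin N)) → Fin M × G × W → ℂ)
    (D : Fin M → Option (Fin N)) (z : Fin M × G × W) :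
    compressedQuery enc (fun D z => Φ D z + Φ' D z) D z
      = compressedQuery enc Φ D z + compressedQuery enc Φ' D z := by
  simp only [compressedQuery, registerQuery, mul_add, Finset.sum_add_distrib]

theorem compressedQuery_eq_zero_of_lt_recordCount {k : ℕ}
    {Φ : (Fin M → Option (Fin N)) → Fin M × G × W → ℂ}
    (h : ∀ D, k < recordCount D → Φ D = 0) {D : Fin M → Option (Fin N)}
    (hD : k + 1 < recordCount D) : compressedQuery enc Φ D = 0 := by
  funext z
  have h0 : ∀ d, Φ (update D z.1 d) = 0 := fun d =>
    h _ (by have := recordCount_le_update_add_one D z.1 d; omega)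
  simp [compressedQuery, registerQuery, h0]

variable [Fintype G] [Fintype W]

theorem sum_norm_sq_compressedQuery_le (Φ : (Fin M → Option (Fin N)) → Fin M × G × W → ℂ) :
    ∑ D, ∑ z, ‖compressedQuery enc Φ D z‖ ^ 2 ≤ ∑ D, ∑ z, ‖Φ D z‖ ^ 2 :=
  sum_le_sum_of_register fun D x w => by
    simp only [compressedQuery_update]
    exact sum_norm_sq_registerQuery_le enc _

open Classical in
/-- A query to a collision-free database with at most `k` records hardly ever creates a
collision. -/
theorem sum_norm_sq_compressedQuery_hasCollision_le {k : ℕ}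
    {Φ : (Fin M → Option (Fin N)) → Fin M × G × W → ℂ} (hk : ∀ D, k < recordCount D → Φ D = 0)
    (hcol : ∀ D, HasCollision D → Φ D = 0) :
    ∑ D, ∑ z, (if HasCollision D then ‖compressedQuery enc Φ D z‖ ^ 2 else 0)
      ≤ 6 * k / N * ∑ D, ∑ z, ‖Φ D z‖ ^ 2 := by
  simp only [Finset.mul_sum]
  refine sum_le_sum_of_register fun D x w => ?_
  simp only [compressedQuery_update, ← Finset.mul_sum]
  -- If no database on this fiber is both collision-free and within `k` records, `Φ` vanishes on the
  -- fiber. Otherwise `d₀` witnesses that the entries away from `x` are collision-free with at most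
  -- `k` records.
  by_cases h0 : ∃ d, ¬ HasCollision (update D x d) ∧ recordCount (update D x d) ≤ k
  · obtain ⟨d₀, hd₀, hr⟩ := h0
    set X : Finset (Fin M) := {x' | update D x d₀ x' ≠ none} with hX
    set I : Finset (Option (Fin N)) :=
      {d | HasCollision (update D x d)} with hI
    -- A collision avoiding `x` would already be present with `d₀`, so the entry at `x` must repeat
    -- one of the values recorded elsewhere.
    have hmem : ∀ d ∈ I, ∃ x' ∈ X, x' ≠ x ∧ D x' = d ∧ ∃ i, d = some i := fun d hd => by
      obtain ⟨x₁, x₂, hne, v, h₁, h₂⟩ : HasCollision (update D x d) := by simpa [hI] using hd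
      by_cases e₁ : x₁ = x
      · subst e₁
        have : D x₂ = some v := by simpa [hne.symm] using h₂
        refine ⟨x₂, by simp [hX, hne.symm, this], hne.symm, ?_, v, by simpa using h₁⟩
        rw [this]; simpa using h₁.symm
      · by_cases e₂ : x₂ = x
        · subst e₂
          have : D x₁ = some v := by simpa [hne] using h₁
          refine ⟨x₁, by simp [hX, hne, this], hne, ?_, v, by simpa using h₂⟩
          rw [this]; simpa using h₂.symm
        · refine absurd ⟨x₁, x₂, hne, v, ?_, ?_⟩ hd₀
          · simpa [e₁] using h₁
          · simpa [e₂] using h₂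
    have hcard : #I ≤ k := by
      refine le_trans ?_ hr
      refine (Finset.card_le_card (t := X.image D) fun d hd => ?_).trans Finset.card_image_le
      obtain ⟨x', h1, -, h2, -⟩ := hmem d hd
      exact Finset.mem_image.2 ⟨x', h1, h2⟩
    have e : ∀ d, (∑ y, if HasCollision (update D x d) then
          ‖registerQuery enc (fun d y => Φ (update D x d) (x, y, w)) d y‖ ^ 2 else 0)
        = if d ∈ I then
          ∑ y, ‖registerQuery enc (fun d y => Φ (update D x d) (x, y, w)) d y‖ ^ 2 else 0 := by
      intro d
      by_cases h : HasCollision (update D x d) <;> simp [hI, h]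
    simp only [e]
    rw [Finset.sum_ite_mem, Finset.univ_inter]
    set S := ∑ d, ∑ y, ‖Φ (update D x d) (x, y, w)‖ ^ 2 with hS
    have hS0 : 0 ≤ S := by positivity
    calc _ ≤ ∑ d ∈ I, 6 / N * S := Finset.sum_le_sum fun d hd => by
          obtain ⟨x', -, -, -, i, rfl⟩ := hmem d hd
          refine sum_norm_sq_registerQuery_some_le enc (funext fun y => ?_)
          have : HasCollision (update D x (some i)) := by simpa [hI] using hd
          simp [hcol _ this]
      _ = (#I : ℝ) * (6 / N * S) := by rw [Finset.sum_const, nsmul_eq_mul]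
      _ ≤ k * (6 / N * S) := by gcongr
      _ = _ := by ring
  · have hz : ∀ d, Φ (update D x d) = 0 := fun d => by
      by_contra hne
      refine h0 ⟨d, fun h => hne (hcol _ h), ?_⟩
      by_contra h
      exact hne (hk _ (by omega))
    simp [registerQuery, hz]

end CompressedQuery

/-! ### Decompressing the whole database, and testing the output pair -/

/-- The amplitudes of the full truth table `f` in a compressed state. -/
noncomputable def decompressAll {M N : ℕ} (φ : (Fin M → Option (Fin N)) → ℂ)
    (f : Fin M → Fin N) : ℂ :=
  ∑ D, ((∏ x, decompress (f x) (D x) : ℝ) : ℂ) * φ D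

section DecompressAll

variable {M N : ℕ}

theorem prod_decompress_orthonormal (f g : Fin M → Fin N) :
    ∑ D : Fin M → Option (Fin N), (∏ x, decompress (f x) (D x)) * ∏ x, decompress (g x) (D x)
      = if f = g then 1 else 0 := by
  simp only [← Finset.prod_mul_distrib]
  rw [← Fintype.prod_sum (f := fun x d => decompress (f x) d * decompress (g x) d)]
  simp only [decompress_orthonormal]
  by_cases h : f = g
  · simp [h]
  · obtain ⟨x, hx⟩ := Function.ne_iff.1 h
    rw [if_neg h]
    exact Finset.prod_eq_zero (Finset.mem_univ x) (if_neg hx)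

theorem sum_norm_sq_decompressAll_le (φ : (Fin M → Option (Fin N)) → ℂ) :
    ∑ f, ‖decompressAll φ f‖ ^ 2 ≤ ∑ D, ‖φ D‖ ^ 2 :=
  sum_norm_sq_le_of_orthonormal prod_decompress_orthonormal φ

theorem prod_decompress_update (f : Fin M → Fin N) (D : Fin M → Option (Fin N)) (x : Fin M)
    (d : Option (Fin N)) : ∏ x', decompress (f x') (update D x d x')
      = decompress (f x) d * ∏ x' ∈ univ.erase x, decompress (f x') (D x') := by
  rw [← Finset.mul_prod_erase _ _ (Finset.mem_univ x), update_self]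
  congr 1
  refine Finset.prod_congr rfl fun x' h => ?_
  rw [update_of_ne (Finset.ne_of_mem_erase h)]

/-- This is `T Tᵀ = 1`: compressing and then decompressing loses nothing. -/
theorem sum_decompress_mul_sum (a : Fin N) (c : Fin N → ℂ) :
    ∑ d, (decompress a d : ℂ) * ∑ v, (decompress v d : ℂ) * c v = c a := by
  simp only [Finset.mul_sum, ← mul_assoc]
  rw [Finset.sum_comm]
  simp only [← Finset.sum_mul, ← Complex.ofReal_mul, ← Complex.ofReal_sum, decompress_orthonormal]
  rw [Finset.sum_eq_single a (fun v _ h => by simp [h.symm]) (by simp)]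
  simp

/-- Decompression turns compressed queries into queries. -/
theorem decompressAll_compressedQuery {G W : Type} [AddCommGroup G] (enc : Fin N ↪ G)
    (Φ : (Fin M → Option (Fin N)) → Fin M × G × W → ℂ) (f : Fin M → Fin N)
    (z : Fin M × G × W) :
    decompressAll (fun D => compressedQuery enc Φ D z) f
      = quantumQuery enc f (fun z => decompressAll (fun D => Φ D z) f) z := by
  obtain ⟨x, y, w⟩ := z
  refine sum_eq_sum_of_update x fun D => ?_
  simp only [prod_decompress_update, compressedQuery, update_idem, update_self, registerQuery]
  push_cast
  simp only [mul_right_comm _ (∏ x' ∈ univ.erase x, (decompress (f x') (D x') : ℂ))]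
  rw [← Finset.sum_mul, ← Finset.sum_mul]
  congr 1
  exact sum_decompress_mul_sum (f x) _

/-- The compressed form of the projection onto the truth tables that agree at `x₁` and `x₂`. -/
noncomputable def compressedCollisionTest (x₁ x₂ : Fin M) (φ : (Fin M → Option (Fin N)) → ℂ)
    (D : Fin M → Option (Fin N)) : ℂ :=
  ∑ v, ((decompress v (D x₁) * decompress v (D x₂) : ℝ) : ℂ) *
    ∑ d₁, ∑ d₂, (decompress v d₁ : ℂ) * decompress v d₂ * φ (update (update D x₁ d₁) x₂ d₂)

theorem sum_eq_sum_of_update_update {x₁ x₂ : Fin M} {a b : (Fin M → Option (Fin N)) → ℂ}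
    (h : ∀ D, ∑ d₁, ∑ d₂, a (update (update D x₁ d₁) x₂ d₂)
      = ∑ d₁, ∑ d₂, b (update (update D x₁ d₁) x₂ d₂)) : ∑ D, a D = ∑ D, b D := by
  have h1 := sum_eq_sum_of_update (a := fun D => ∑ d₂, a (update D x₂ d₂))
    (b := fun D => ∑ d₂, b (update D x₂ d₂)) x₁ h
  rw [sum_sum_update, sum_sum_update] at h1
  exact mul_left_cancel₀ (by exact_mod_cast Fintype.card_ne_zero) h1

theorem sum_le_sum_of_update_update {x₁ x₂ : Fin M} {a b : (Fin M → Option (Fin N)) → ℝ}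
    (h : ∀ D, ∑ d₁, ∑ d₂, a (update (update D x₁ d₁) x₂ d₂)
      ≤ ∑ d₁, ∑ d₂, b (update (update D x₁ d₁) x₂ d₂)) : ∑ D, a D ≤ ∑ D, b D := by
  have h1 := sum_le_sum_of_update (a := fun D => ∑ d₂, a (update D x₂ d₂))
    (b := fun D => ∑ d₂, b (update D x₂ d₂)) x₁ h
  rw [sum_sum_update, sum_sum_update] at h1
  exact le_of_mul_le_mul_left h1 (by exact_mod_cast Fintype.card_pos)

theorem compressedCollisionTest_update {x₁ x₂ : Fin M} (hne : x₁ ≠ x₂)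
    (φ : (Fin M → Option (Fin N)) → ℂ) (D : Fin M → Option (Fin N)) (e₁ e₂ : Option (Fin N)) :
    compressedCollisionTest x₁ x₂ φ (update (update D x₁ e₁) x₂ e₂)
      = ∑ v, ((decompress v e₁ * decompress v e₂ : ℝ) : ℂ) *
        ∑ d₁, ∑ d₂, (decompress v d₁ : ℂ) * decompress v d₂ *
          φ (update (update D x₁ d₁) x₂ d₂) := by
  have h : ∀ d₁, update (update (update D x₁ e₁) x₂ e₂) x₁ d₁
      = update (update D x₁ d₁) x₂ e₂ := fun d₁ => by
    rw [update_comm hne.symm, update_idem]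
  simp [compressedCollisionTest, h, update_of_ne hne]

/-- With `P` the projection onto agreement at the two points, the test is `Tᵀ P T` on the two
registers. Hence decompressing it gives `P T φ`, and `P` fixes the amplitude at any `f` with `f x₁ =
f x₂`. -/
theorem decompressAll_compressedCollisionTest {x₁ x₂ : Fin M} (hne : x₁ ≠ x₂)
    (φ : (Fin M → Option (Fin N)) → ℂ) (f : Fin M → Fin N) (hf : f x₁ = f x₂) :
    decompressAll (compressedCollisionTest x₁ x₂ φ) f = decompressAll φ f := by
  refine sum_eq_sum_of_update_update (x₁ := x₁) (x₂ := x₂) fun D => ?_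
  have hprod : ∀ d₁ d₂, ∏ x', decompress (f x') (update (update D x₁ d₁) x₂ d₂ x')
      = decompress (f x₁) d₁ * decompress (f x₁) d₂
        * ∏ x' ∈ (univ.erase x₂).erase x₁, decompress (f x') (D x') := fun d₁ d₂ => by
    rw [prod_decompress_update,
      ← Finset.mul_prod_erase _ _ (Finset.mem_erase.2 ⟨hne, Finset.mem_univ x₁⟩), update_self, ← hf]
    rw [mul_left_comm, ← mul_assoc]
    congr 1
    refine Finset.prod_congr rfl fun x' h => ?_
    rw [update_of_ne (Finset.ne_of_mem_erase h)]
  simp only [compressedCollisionTest_update hne, hprod]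
  set R := ∏ x' ∈ (univ.erase x₂).erase x₁, decompress (f x') (D x')
  set g : Fin N → ℂ := fun v => ∑ d₁, ∑ d₂, (decompress v d₁ : ℂ) * decompress v d₂ *
          φ (update (update D x₁ d₁) x₂ d₂) with hg
  have h1 : ∀ d₁, ∑ d₂, (decompress (f x₁) d₂ : ℂ) *
      (∑ v, ((decompress v d₁ * decompress v d₂ : ℝ) : ℂ) * g v)
      = decompress (f x₁) d₁ * g (f x₁) := fun d₁ => by
    rw [← sum_decompress_mul_sum (f x₁) fun v => (decompress v d₁ : ℂ) * g v]
    refine Finset.sum_congr rfl fun d₂ _ => ?_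
    congr 1
    refine Finset.sum_congr rfl fun v _ => ?_
    push_cast
    ring
  calc _ = ∑ d₁, (R : ℂ) * decompress (f x₁) d₁ * ∑ d₂, (decompress (f x₁) d₂ : ℂ) *
      (∑ v, ((decompress v d₁ * decompress v d₂ : ℝ) : ℂ) * g v) := by
        refine Finset.sum_congr rfl fun d₁ _ => ?_
        rw [Finset.mul_sum]
        refine Finset.sum_congr rfl fun d₂ _ => ?_
        push_cast
        ring
    _ = (R : ℂ) * (∑ d₁, (decompress (f x₁) d₁ : ℂ) * decompress (f x₁) d₁) * g (f x₁) := by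
        simp only [h1]
        rw [mul_assoc (R : ℂ), Finset.sum_mul, Finset.mul_sum]
        exact Finset.sum_congr rfl fun d₁ _ => by ring
    _ = (R : ℂ) * g (f x₁) := by
        simp only [← Complex.ofReal_mul, ← Complex.ofReal_sum, decompress_orthonormal]
        simp
    _ = _ := by
        simp only [hg, Finset.mul_sum]
        refine Finset.sum_congr rfl fun d₁ _ => Finset.sum_congr rfl fun d₂ _ => ?_
        push_cast
        ring

/-- The tensor squares of the rows of `T` are again orthonormal, so the test has the same norm as
the diagonal amplitudes bounded in `sum_norm_sq_decompress_diag_le`. -/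
theorem sum_norm_sq_compressedCollisionTest_le {x₁ x₂ : Fin M} (hne : x₁ ≠ x₂)
    {φ : (Fin M → Option (Fin N)) → ℂ} (hcol : ∀ D, HasCollision D → φ D = 0) :
    ∑ D, ‖compressedCollisionTest x₁ x₂ φ D‖ ^ 2 ≤ 8 / N * ∑ D, ‖φ D‖ ^ 2 := by
  rw [Finset.mul_sum]
  refine sum_le_sum_of_update_update (x₁ := x₁) (x₂ := x₂) fun D => ?_
  simp only [compressedCollisionTest_update hne, ← Finset.mul_sum]
  have hpair : ∀ a b : Fin N, ∑ p : Option (Fin N) × Option (Fin N),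
      (decompress a p.1 * decompress a p.2) * (decompress b p.1 * decompress b p.2)
        = if a = b then 1 else 0 := fun a b => by
    have : ∀ p : Option (Fin N) × Option (Fin N),
        (decompress a p.1 * decompress a p.2) * (decompress b p.1 * decompress b p.2)
        = (decompress a p.1 * decompress b p.1) * (decompress a p.2 * decompress b p.2) :=
      fun p => by ring
    simp only [this, Fintype.sum_prod_type, ← Finset.mul_sum, ← Finset.sum_mul,
      decompress_orthonormal]
    split_ifs <;> simp
  have h1 := sum_norm_sq_transpose_of_orthonormal
    (t := fun v (p : Option (Fin N) × Option (Fin N)) => decompress v p.1 * decompress v p.2) hpair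
    (fun v => ∑ d₁, ∑ d₂, (decompress v d₁ : ℂ) * decompress v d₂ *
          φ (update (update D x₁ d₁) x₂ d₂))
  rw [Fintype.sum_prod_type] at h1
  rw [h1]
  refine sum_norm_sq_decompress_diag_le fun v => hcol _ ⟨x₁, x₂, hne, v, ?_, ?_⟩
  · rw [update_of_ne hne, update_self]
  · rw [update_self]

open Classical in
/-- A compressed state without recorded collisions hardly ever decompresses to a truth table with
a given collision. -/
theorem sum_norm_sq_decompressAll_isCollision_le (p : Fin M × Fin M)
    {φ : (Fin M → Option (Fin N)) → ℂ} (hcol : ∀ D, HasCollision D → φ D = 0) :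
    ∑ f : Fin M → Fin N, (if IsCollision f p then ‖decompressAll φ f‖ ^ 2 else 0)
      ≤ 8 / N * ∑ D, ‖φ D‖ ^ 2 := by
  by_cases hne : p.1 = p.2
  · have : ∀ f : Fin M → Fin N, ¬ IsCollision f p := fun f h => h.1 hne
    simp only [this, if_false, Finset.sum_const_zero]
    positivity
  · refine le_trans ?_ (sum_norm_sq_compressedCollisionTest_le hne hcol)
    -- On colliding `f` the tested state has the same decompressed amplitude; the other terms only
    -- increase the sum, and decompression is a contraction.
    refine le_trans (Finset.sum_le_sum fun f _ => ?_) (sum_norm_sq_decompressAll_le _)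
    split_ifs with h
    · rw [decompressAll_compressedCollisionTest hne φ f h.2]
    · positivity

end DecompressAll

/-! ### The compressed run of the algorithm -/

/-- A unitary matrix preserves the sum of squares. -/
theorem sum_norm_sq_unitary_mulVec {n : Type*} [Fintype n] [DecidableEq n]
    (U : Matrix.unitaryGroup n ℂ) (φ : n → ℂ) :
    ∑ z, ‖(U : Matrix n n ℂ).mulVec φ z‖ ^ 2 = ∑ z, ‖φ z‖ ^ 2 := by
  have h : ∀ ψ : n → ℂ, ((∑ z, ‖ψ z‖ ^ 2 : ℝ) : ℂ) = star ψ ⬝ᵥ ψ := fun ψ => by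
    simp [dotProduct, ← Complex.conj_mul']
  apply Complex.ofReal_injective
  rw [h, h, Matrix.star_mulVec, Matrix.dotProduct_mulVec, Matrix.vecMul_vecMul,
    ← Matrix.star_eq_conjTranspose, Matrix.UnitaryGroup.star_mul_self, Matrix.vecMul_one]

namespace QueryAlgorithm

variable {M N : ℕ} {G : Type} [AddCommGroup G] [Fintype G] [DecidableEq G] {q : ℕ}

/-- The state after `k` queries, with the random function kept as a compressed database. -/
noncomputable def compressedState (A : QueryAlgorithm M G q) (enc : Fin N ↪ G) :
    (k : ℕ) → k ≤ q → (Fin M → Option (Fin N)) → Fin M × G × Fin A.dim → ℂ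
  | 0, _ => fun D => (A.U 0 : Matrix _ _ ℂ).mulVec
      (if D = fun _ => none then Pi.single A.start 1 else 0)
  | k + 1, hk => fun D => (A.U ⟨k + 1, Nat.lt_succ_of_le hk⟩ : Matrix _ _ ℂ).mulVec
      (compressedQuery enc (A.compressedState enc k (Nat.le_of_succ_le hk)) D)

variable (A : QueryAlgorithm M G q) (enc : Fin N ↪ G)

theorem decompressAll_mulVec {Z : Type*} [Fintype Z] (U : Matrix Z Z ℂ)
    (Φ : (Fin M → Option (Fin N)) → Z → ℂ) (f : Fin M → Fin N) :
    (fun z => decompressAll (fun D => U.mulVec (Φ D) z) f)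
      = U.mulVec fun z => decompressAll (fun D => Φ D z) f := by
  funext z
  simp only [decompressAll, Matrix.mulVec, dotProduct, Finset.mul_sum]
  rw [Finset.sum_comm]
  exact Finset.sum_congr rfl fun _ _ => Finset.sum_congr rfl fun _ _ => by ring

/-- Decompressing the compressed state gives the uniform superposition over `f` of the states of
the algorithm run with queries to `f`. -/
theorem decompressAll_compressedState (f : Fin M → Fin N) : ∀ (k : ℕ) (hk : k ≤ q),
    (fun z => decompressAll (fun D => A.compressedState enc k hk D z) f)
      = (((1 / √N) ^ M : ℝ) : ℂ) • A.stateAfter enc f k hk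
  | 0, _ => by
    simp only [compressedState, stateAfter]
    rw [decompressAll_mulVec, ← Matrix.mulVec_smul]
    congr 1
    funext z
    rw [decompressAll, Finset.sum_eq_single (fun _ => none) (fun D _ h => by simp [h]) (by simp)]
    simp [decompress]
  | k + 1, hk => by
    have ih := decompressAll_compressedState f k (Nat.le_of_succ_le hk)
    simp only [compressedState, stateAfter]
    rw [decompressAll_mulVec, ← Matrix.mulVec_smul]
    congr 1
    funext z
    rw [decompressAll_compressedQuery, ih]
    rfl

theorem sum_norm_sq_compressedState_le : ∀ (k : ℕ) (hk : k ≤ q),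
    ∑ D, ∑ z, ‖A.compressedState enc k hk D z‖ ^ 2 ≤ 1
  | 0, _ => by
    simp only [compressedState, sum_norm_sq_unitary_mulVec]
    rw [Finset.sum_eq_single (fun _ => none) (fun D _ h => by simp [h]) (by simp), if_pos rfl,
      Finset.sum_eq_single A.start (fun z _ h => by simp [h]) (by simp)]
    simp
  | k + 1, hk => by
    simp only [compressedState, sum_norm_sq_unitary_mulVec]
    exact (sum_norm_sq_compressedQuery_le enc _).trans
      (sum_norm_sq_compressedState_le k (Nat.le_of_succ_le hk))

theorem compressedState_eq_zero_of_lt_recordCount : ∀ (k : ℕ) (hk : k ≤ q)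
    (D : Fin M → Option (Fin N)), k < recordCount D → A.compressedState enc k hk D = 0
  | 0, _, D, hD => by
    have h : D ≠ fun _ => none := by rintro rfl; simp [recordCount] at hD
    simp [compressedState, h]
  | k + 1, hk, D, hD => by
    have ih := compressedState_eq_zero_of_lt_recordCount k (Nat.le_of_succ_le hk)
    simp [compressedState, compressedQuery_eq_zero_of_lt_recordCount enc ih hD]

/-- A constant factor 2 here would compound exponentially over the queries. The weight `1 + 1 / (k +
1)` on the old collision part keeps the growth polynomial. -/
theorem norm_add_sq_le_weighted (k : ℕ) (x y : ℂ) :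
    ‖x + y‖ ^ 2 ≤ ((k : ℝ) + 2) / (k + 1) * ‖x‖ ^ 2 + (k + 2) * ‖y‖ ^ 2 := by
  have h : ‖x + y‖ ^ 2 ≤ (‖x‖ + ‖y‖) ^ 2 := by gcongr; exact norm_add_le x y
  refine h.trans (le_of_sub_nonneg ?_)
  have e : ((k : ℝ) + 2) / (k + 1) * ‖x‖ ^ 2 + (k + 2) * ‖y‖ ^ 2 - (‖x‖ + ‖y‖) ^ 2
      = (‖x‖ - (k + 1) * ‖y‖) ^ 2 / (k + 1) := by
    field_simp
    ring
  rw [e]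
  positivity

open Classical in
/-- After `k` queries the database hardly ever holds a collision. -/
theorem sum_norm_sq_compressedState_hasCollision_le : ∀ (k : ℕ) (hk : k ≤ q),
    ∑ D, ∑ z, (if HasCollision D then ‖A.compressedState enc k hk D z‖ ^ 2 else 0)
      ≤ 6 * (k : ℝ) ^ 3 / N
  | 0, _ => by
    have h : ¬ HasCollision (fun _ : Fin M => (none : Option (Fin N))) := by
      simp [HasCollision]
    have h0 : ∀ (D : Fin M → Option (Fin N)) z, (if HasCollision D then
        ‖A.compressedState enc 0 (Nat.zero_le q) D z‖ ^ 2 else 0) = 0 := fun D z => by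
      split_ifs with hD
      · have : D ≠ fun _ => none := by rintro rfl; exact h hD
        simp [compressedState, this]
      · rfl
    simp only [h0]
    simp
  | k + 1, hk => by
    have hk' := Nat.le_of_succ_le hk
    have ih := sum_norm_sq_compressedState_hasCollision_le k hk'
    set Φ := A.compressedState enc k hk' with hΦ
    set Φ₁ : (Fin M → Option (Fin N)) → Fin M × G × Fin A.dim → ℂ :=
      fun D z => if HasCollision D then Φ D z else 0 with hΦ₁
    set Φ₂ : (Fin M → Option (Fin N)) → Fin M × G × Fin A.dim → ℂ :=
      fun D z => if HasCollision D then 0 else Φ D z with hΦ₂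
    have hsum : Φ = fun D z => Φ₁ D z + Φ₂ D z := by
      funext D z
      simp only [hΦ₁, hΦ₂]
      split_ifs <;> simp
    have e1 : ∑ D, ∑ z, ‖Φ₁ D z‖ ^ 2
        = ∑ D, ∑ z, (if HasCollision D then ‖Φ D z‖ ^ 2 else 0) :=
      Finset.sum_congr rfl fun D _ => Finset.sum_congr rfl fun z _ => by
        simp only [hΦ₁]; split_ifs <;> simp
    have h1 : ∑ D, ∑ z, ‖compressedQuery enc Φ₁ D z‖ ^ 2 ≤ 6 * (k : ℝ) ^ 3 / N :=
      (sum_norm_sq_compressedQuery_le enc Φ₁).trans (e1.le.trans ih)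
    have h2' : ∑ D, ∑ z, ‖Φ₂ D z‖ ^ 2 ≤ 1 := by
      refine le_trans (Finset.sum_le_sum fun D _ => Finset.sum_le_sum fun z _ => ?_)
        (A.sum_norm_sq_compressedState_le enc k hk')
      simp only [hΦ₂]
      split_ifs
      · simp
      · exact le_rfl
    have h2 : ∑ D, ∑ z, (if HasCollision D then ‖compressedQuery enc Φ₂ D z‖ ^ 2 else 0)
        ≤ 6 * (k : ℝ) / N := by
      refine (sum_norm_sq_compressedQuery_hasCollision_le enc (k := k) ?_ ?_).trans
        (mul_le_of_le_one_right (by positivity) h2')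
      · intro D hD
        have := A.compressedState_eq_zero_of_lt_recordCount enc k hk' D hD
        funext z
        simp [hΦ₂, hΦ, this]
      · intro D hD
        funext z
        simp [hΦ₂, hD]
    have h3 : ∀ D : Fin M → Option (Fin N),
        ∑ z, (if HasCollision D then ‖A.compressedState enc (k + 1) hk D z‖ ^ 2 else 0)
        ≤ ((k : ℝ) + 2) / (k + 1) * ∑ z, ‖compressedQuery enc Φ₁ D z‖ ^ 2
          + (k + 2) * ∑ z, (if HasCollision D then ‖compressedQuery enc Φ₂ D z‖ ^ 2 else 0) := by
      intro D
      by_cases hD : HasCollision D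
      -- The unitary acts only on the registers of the algorithm, for each database separately, and
      -- so moves no mass between databases.
      · simp only [hD, if_true, compressedState, sum_norm_sq_unitary_mulVec]
        rw [← hΦ, hsum, Finset.mul_sum, Finset.mul_sum, ← Finset.sum_add_distrib]
        refine Finset.sum_le_sum fun z _ => ?_
        rw [compressedQuery_add]
        exact norm_add_sq_le_weighted k _ _
      · simp only [hD, if_false, Finset.sum_const_zero, mul_zero, add_zero]
        positivity
    refine (Finset.sum_le_sum fun D _ => h3 D).trans ?_
    rw [Finset.sum_add_distrib, ← Finset.mul_sum, ← Finset.mul_sum]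
    -- The induction closes because `k ^ 4 + 3 * k ^ 3 + 3 * k ^ 2 + 2 * k ≤ (k + 1) ^ 4`.
    calc _ ≤ ((k : ℝ) + 2) / (k + 1) * (6 * (k : ℝ) ^ 3 / N) + (k + 2) * (6 * (k : ℝ) / N) := by
          gcongr
      _ = 6 * ((((k : ℝ) + 2) * k ^ 3 + (k + 2) * k * (k + 1)) / (k + 1)) / N := by
          field_simp
      _ ≤ 6 * ((k : ℝ) + 1) ^ 3 / N := by
          gcongr
          rw [div_le_iff₀ (by positivity)]
          nlinarith [sq_nonneg (k : ℝ), pow_nonneg (Nat.cast_nonneg k : (0 : ℝ) ≤ k) 3,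
            (Nat.cast_nonneg k : (0 : ℝ) ≤ k)]
      _ = _ := by push_cast; ring

open Classical in
/-- The success probability, read off the compressed state. -/
theorem randomCollisionProb_eq (hN : 0 < N) : A.randomCollisionProb enc
    = ∑ z, ∑ f, if IsCollision f (A.out z) then
        ‖decompressAll (fun D => A.compressedState enc q le_rfl D z) f‖ ^ 2 else 0 := by
  have hN' : (0 : ℝ) < N := by exact_mod_cast hN
  -- The squared normalisation of the superposition is the probability of each single `f`.
  have hs : ((1 / √(N : ℝ)) ^ M) ^ 2 = 1 / (N : ℝ) ^ M := by
    rw [← pow_mul, mul_comm, pow_mul, div_pow, Real.sq_sqrt hN'.le]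
    simp
  rw [randomCollisionProb, Finset.sum_comm, Finset.sum_div]
  refine Finset.sum_congr rfl fun f _ => ?_
  rw [collisionProb, Finset.sum_div]
  refine Finset.sum_congr rfl fun z _ => ?_
  rw [congrFun (A.decompressAll_compressedState enc f q le_rfl) z]
  rw [Pi.smul_apply, smul_eq_mul, norm_mul, mul_pow, Complex.norm_real, Real.norm_eq_abs, sq_abs,
    hs]
  simp only [Fintype.card_fun, Fintype.card_fin, Nat.cast_pow]
  split_ifs <;> ring

theorem randomCollisionProb_le (hN : 0 < N) :
    A.randomCollisionProb enc ≤ 16 * ((q : ℝ) + 1) ^ 3 / N := by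
  classical
  rw [A.randomCollisionProb_eq enc hN]
  set Φ := A.compressedState enc q le_rfl with hΦ
  set Φ₁ : (Fin M → Option (Fin N)) → Fin M × G × Fin A.dim → ℂ :=
    fun D z => if HasCollision D then Φ D z else 0 with hΦ₁
  set Φ₂ : (Fin M → Option (Fin N)) → Fin M × G × Fin A.dim → ℂ :=
    fun D z => if HasCollision D then 0 else Φ D z with hΦ₂
  have hsum : ∀ D z, Φ D z = Φ₁ D z + Φ₂ D z := fun D z => by
    simp only [hΦ₁, hΦ₂]
    split_ifs <;> simp
  have e1 : ∑ z, ∑ D, ‖Φ₁ D z‖ ^ 2 ≤ 6 * (q : ℝ) ^ 3 / N := by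
    rw [Finset.sum_comm]
    refine le_trans (le_of_eq ?_) (A.sum_norm_sq_compressedState_hasCollision_le enc q le_rfl)
    exact Finset.sum_congr rfl fun D _ => Finset.sum_congr rfl fun z _ => by
      simp only [hΦ₁]; split_ifs <;> simp [hΦ]
  have e2 : ∑ z, ∑ D, ‖Φ₂ D z‖ ^ 2 ≤ 1 := by
    rw [Finset.sum_comm]
    refine le_trans (Finset.sum_le_sum fun D _ => Finset.sum_le_sum fun z _ => ?_)
      (A.sum_norm_sq_compressedState_le enc q le_rfl)
    simp only [hΦ₂]
    split_ifs
    · simp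
    · exact le_rfl
  have h : ∀ z, (∑ f, if IsCollision f (A.out z) then ‖decompressAll (fun D => Φ D z) f‖ ^ 2 else 0)
      ≤ 2 * (∑ D, ‖Φ₁ D z‖ ^ 2) + 2 * (8 / N * ∑ D, ‖Φ₂ D z‖ ^ 2) := fun z => by
    have h1 := sum_norm_sq_decompressAll_le fun D => Φ₁ D z
    have h2 := sum_norm_sq_decompressAll_isCollision_le (A.out z) (φ := fun D => Φ₂ D z)
      fun D hD => by simp [hΦ₂, hD]
    refine le_trans ?_ (add_le_add (mul_le_mul_of_nonneg_left h1 zero_le_two)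
      (mul_le_mul_of_nonneg_left h2 zero_le_two))
    rw [Finset.mul_sum, Finset.mul_sum, ← Finset.sum_add_distrib]
    refine Finset.sum_le_sum fun f _ => ?_
    split_ifs
    · have e : decompressAll (fun D => Φ D z) f
          = decompressAll (fun D => Φ₁ D z) f + decompressAll (fun D => Φ₂ D z) f := by
        simp only [decompressAll, hsum, mul_add, Finset.sum_add_distrib]
      rw [e]
      exact norm_add_sq_le_two_mul _ _
    · positivity
  refine (Finset.sum_le_sum fun z _ => h z).trans ?_
  rw [Finset.sum_add_distrib, ← Finset.mul_sum, ← Finset.mul_sum, ← Finset.mul_sum]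
  calc _ ≤ 2 * (6 * (q : ℝ) ^ 3 / N) + 2 * (8 / N * 1) := by gcongr
    _ = (12 * (q : ℝ) ^ 3 + 16) / N := by ring
    _ ≤ _ := by
        gcongr
        nlinarith [sq_nonneg (q : ℝ), pow_nonneg (Nat.cast_nonneg q : (0 : ℝ) ≤ q) 3,
            (Nat.cast_nonneg q : (0 : ℝ) ≤ q)]

end QueryAlgorithm

/-! ### From the success bound to the query bound -/

/-- A success bound of order `q ^ 3 / N` gives a query bound of order `N ^ (1 / 3)`. -/
theorem exists_mul_rpow_le_of_le_cube_div {C p : ℝ} (hC : 0 < C) (hp : 0 < p) :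
    ∃ c : ℝ, 0 < c ∧ ∃ N₀ : ℕ, 0 < N₀ ∧ ∀ N q : ℕ, N₀ ≤ N →
      p ≤ C * ((q : ℝ) + 1) ^ 3 / N → c * (N : ℝ) ^ (1 / 3 : ℝ) ≤ q := by
  -- Once `N > C / p`, zero queries cannot reach success `p`. Then `q + 1 ≤ 2 * q`, whence the 8 in
  -- the constant.
  obtain ⟨n, hn⟩ := exists_nat_gt (C / p)
  refine ⟨(p / (8 * C)) ^ (1 / 3 : ℝ), by positivity, n + 1, n.succ_pos, fun N q hNq h => ?_⟩
  have hN : (n : ℝ) + 1 ≤ N := by exact_mod_cast hNq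
  have hN0 : (0 : ℝ) < N := by have : (0 : ℝ) ≤ n := n.cast_nonneg; linarith
  rw [le_div_iff₀ hN0] at h
  have hq : 1 ≤ q := by
    by_contra hq
    obtain rfl : q = 0 := by omega
    rw [div_lt_iff₀ hp] at hn
    norm_num at h
    nlinarith
  have hq' : (1 : ℝ) ≤ q := by exact_mod_cast hq
  rw [← Real.mul_rpow (by positivity) (by positivity)]
  have h8 : p / (8 * C) * N ≤ (q : ℝ) ^ (3 : ℕ) := by
    rw [div_mul_eq_mul_div, div_le_iff₀ (by positivity)]
    have : ((q : ℝ) + 1) ^ 3 ≤ (2 * q) ^ 3 := by gcongr; linarith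
    nlinarith
  calc _ ≤ ((q : ℝ) ^ (3 : ℕ)) ^ (1 / 3 : ℝ) := by gcongr
    _ = q := by
      rw [one_div]
      exact_mod_cast Real.pow_rpow_inv_natCast (by positivity : (0 : ℝ) ≤ q) three_ne_zero

theorem mainTheorem1 :
    (∃ C : ℝ, 0 < C ∧
      ∀ (M N q : ℕ), 0 < N →
        ∀ (G : Type) [AddCommGroup G] [Fintype G] [DecidableEq G] (enc : Fin N ↪ G)
          (A : QueryAlgorithm M G q),
          A.randomCollisionProb enc ≤ C * ((q : ℝ) + 1) ^ 3 / (N : ℝ)) ∧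
    (∀ p : ℝ, 0 < p →
      ∃ c : ℝ, 0 < c ∧ ∃ N₀ : ℕ, ∀ (M N q : ℕ), N₀ ≤ N →
        ∀ (G : Type) [AddCommGroup G] [Fintype G] [DecidableEq G] (enc : Fin N ↪ G)
          (A : QueryAlgorithm M G q),
          p ≤ A.randomCollisionProb enc → c * (N : ℝ) ^ (1 / 3 : ℝ) ≤ (q : ℝ)) := by
  refine ⟨⟨16, by norm_num, fun M N q hN G _ _ _ enc A => A.randomCollisionProb_le enc hN⟩,
    fun p hp => ?_⟩
  obtain ⟨c, hc, N₀, hN₀, h⟩ := exists_mul_rpow_le_of_le_cube_div (C := 16) (by norm_num) hp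
  exact ⟨c, hc, N₀, fun M N q hN G _ _ _ enc A hA =>
    h N q hN (hA.trans (A.randomCollisionProb_le enc (hN₀.trans_le hN)))⟩
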